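/- Let $1\le s\le n$ be integers and let $C\in\mathbb R^{n\times n}$ be symmetric positive definite, with smallest eigenvalue $t:=\lambda_{\min}(C)>0$. Let $A\in\mathbb R^{n\times n}$ be any matrix with $C-tI=A^{\top}A$, let $a_i$ be the $i$-th column of $A$, and for $x\in[0,1]^n$ put $M_t(x)=\sum_{i=1}^n x_i\,a_ia_i^{\top}$. For a symmetric matrix $X$ let $\lambda_1(X)\ge\dots\ge\lambda_n(X)$ be its eigenvalues in nonincreasing order, counted with multiplicity. For positive semidefinite $X$ let $\Phi_s(X;t)=\sum_{i=1}^s\log(\lambda_i(X)+t)$, and let $\widehat\Phi_s(\cdot\,;t)$ be the concave envelope of $\Phi_s(\cdot\,;t)$ on the cone of positive semidefinite $n\times n$ matrices, that is, the pointwise infimum of all concave functions on this cone that are at least $\Phi_s(\cdot\,;t)$ there. Let $F=\{x\in[0,1]^n:\sum_{i=1}^n x_i=s\}$ and $$\hat z=\max_{x\in F}\widehat\Phi_s\big(M_t(x);t\big),\qquad \hat z^D=\max_{x\in F}\log\det\big(M_t(x)+tI\big)-(n-s)\log t .$$ Suppose that $x^*\in F$ attains the maximum that defines $\hat z$, and let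 $\lambda^*_i=\lambda_i(M_t(x^*))$ for $1\le i\le n$, with the convention $\lambda^*_{n+1}=0$. Then the maximum that defines $\hat z^D$ is attained, and $$\hat z^D-\hat z\;\ge\;\Theta^{lb}:=\left(\frac1{\lambda^*_{s+1}+\lambda_{\min}(C)}-\frac1{\lambda^*_{s}+\lambda_{\min}(C)}\right)\sum_{i=s+1}^n\lambda^*_i\;\ge\;0 .$$ -/

import Mathlib

open scoped Matrix

noncomputable section

namespace MESP

variable {n : ℕ}

/-- `eig X i` is the `i`-th largest eigenvalue of the symmetric matrix `X`, counted with
multiplicity, for `i = 1, …, n`; it is `0` for every other index `i`. -/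
def eig (X : Matrix (Fin n) (Fin n) ℝ) (i : ℕ) : ℝ :=
  open Classical in
  if h : X.IsHermitian ∧ 1 ≤ i ∧ i ≤ n then
    h.1.eigenvalues₀ ⟨i - 1, by rw [Fintype.card_fin]; omega⟩
  else 0

/-- The smallest eigenvalue of a symmetric `n × n` matrix, `n ≥ 1`. -/
def lambdaMin (X : Matrix (Fin n) (Fin n) ℝ) : ℝ := eig X n

/-- The matrix `∑ i, x i • a_i a_iᵀ`, where `a_i` is the `i`-th column of `A`. -/
def M (A : Matrix (Fin n) (Fin n) ℝ) (x : Fin n → ℝ) : Matrix (Fin n) (Fin n) ℝ :=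
  ∑ i, x i • Matrix.vecMulVec (A.col i) (A.col i)

/-- `Φ_s(X; t)`: the sum of `log (λ_i(X) + t)` over the `s` largest eigenvalues of `X`. -/
def Phi (s : ℕ) (t : ℝ) (X : Matrix (Fin n) (Fin n) ℝ) : ℝ :=
  ∑ i ∈ Finset.Icc 1 s, Real.log (eig X i + t)

/-- The concave envelope of `f` on the convex set `D`: the pointwise infimum of all concave
functions on `D` that are at least `f` on `D`. -/
def concaveEnvelope {E : Type*} [AddCommGroup E] [Module ℝ E] (D : Set E) (f : E → ℝ) (x : E) :
    ℝ :=
  sInf {y : ℝ | ∃ g : E → ℝ, ConcaveOn ℝ D g ∧ (∀ z ∈ D, f z ≤ g z) ∧ y = g x}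

/-- The concave envelope of `X ↦ Φ_s(X; t)` on the cone of positive semidefinite matrices. -/
def PhiHat (s : ℕ) (t : ℝ) (X : Matrix (Fin n) (Fin n) ℝ) : ℝ :=
  concaveEnvelope {Y : Matrix (Fin n) (Fin n) ℝ | Y.PosSemidef} (Phi s t) X

/-- The points of `[0,1]^n` whose coordinates sum to `s`. -/
def feasible (n s : ℕ) : Set (Fin n → ℝ) :=
  {x | (∀ i, x i ∈ Set.Icc (0 : ℝ) 1) ∧ ∑ i, x i = (s : ℝ)}

/-- The objective function of the augmented factorization bound. -/
def augFactObj (A : Matrix (Fin n) (Fin n) ℝ) (s : ℕ) (t : ℝ) (x : Fin n → ℝ) : ℝ :=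
  PhiHat s t (M A x)

/-- The augmented factorization bound (Aug-Fact). -/
def zHat (A : Matrix (Fin n) (Fin n) ℝ) (s : ℕ) (t : ℝ) : ℝ :=
  sSup (augFactObj A s t '' feasible n s)

/-- The objective function of the relaxed D-optimal data fusion problem, without its
additive constant. -/
def ddfObj (A : Matrix (Fin n) (Fin n) ℝ) (t : ℝ) (x : Fin n → ℝ) : ℝ :=
  Real.log (M A x + t • (1 : Matrix (Fin n) (Fin n) ℝ)).det

/-- The D-optimal data fusion relaxation bound (DDF-R). -/
def zHatD (A : Matrix (Fin n) (Fin n) ℝ) (s : ℕ) (t : ℝ) : ℝ :=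
  sSup (ddfObj A t '' feasible n s) - ((n : ℝ) - (s : ℝ)) * Real.log t

end MESP

end

open scoped Matrix

namespace MESP

/-! Fix a positive semidefinite `X` with eigenvalues `λ_i`. An affine function of `Y`, diagonal in
an eigenbasis of `X` with slopes `w_i = 1 / (λ_{min(i,s)} + t)`, majorizes `Φ_s`: the tangent
inequality for `log` treats the top `s` eigenvalues, and since `w` is nondecreasing, rearrangement
over doubly stochastic matrices bounds the linear part below by `∑ w_i λ_i(Y)`. Its value at `X`
bounds the envelope (`PhiHat_le`), with excess `(∑_{i>s} λ_i) / (λ_s + t)` over `Φ_s(X)`. In `log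
det`, the tail minus `(n - s) log t` is at least `∑_{i>s} λ_i / (λ_i + t) ≥ (∑_{i>s} λ_i) / (λ_{s+1}
+ t)`. Subtracting gives the gap at `X` (`le_log_det_sub_PhiHat`); take `X = M A x` at the given
maximizer. -/

/-- Rearrangement inequality for doubly stochastic matrices. -/
theorem _root_.Antivary.sum_mul_le_dotProduct_mulVec {ι : Type*} [Fintype ι] [DecidableEq ι]
    {w v : ι → ℝ} (h : Antivary w v) {D : Matrix ι ι ℝ} (hD : D ∈ doublyStochastic ℝ ι) :
    ∑ i, w i * v i ≤ w ⬝ᵥ (D *ᵥ v) := by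
  have hconv : Convex ℝ {D : Matrix ι ι ℝ | ∑ i, w i * v i ≤ w ⬝ᵥ (D *ᵥ v)} := by
    intro X hX Y hY a b ha hb hab
    simp only [Set.mem_ofPred_eq] at hX hY ⊢
    rw [Matrix.add_mulVec, Matrix.smul_mulVec, Matrix.smul_mulVec, dotProduct_add,
      dotProduct_smul, dotProduct_smul, smul_eq_mul, smul_eq_mul]
    have h1 := mul_le_mul_of_nonneg_left hX ha
    have h2 := mul_le_mul_of_nonneg_left hY hb
    calc ∑ i, w i * v i = a * ∑ i, w i * v i + b * ∑ i, w i * v i := by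
          rw [← add_mul, hab, one_mul]
      _ ≤ _ := add_le_add h1 h2
  have hsub : {σ.permMatrix ℝ | σ : Equiv.Perm ι} ⊆
      {D : Matrix ι ι ℝ | ∑ i, w i * v i ≤ w ⬝ᵥ (D *ᵥ v)} := by
    rintro _ ⟨σ, rfl⟩
    simp only [Set.mem_ofPred_eq, Matrix.permMatrix_mulVec]
    exact h.sum_mul_le_sum_mul_comp_perm
  have hmem : D ∈ (doublyStochastic ℝ ι : Set (Matrix ι ι ℝ)) := hD
  -- Birkhoff's theorem reduces the claim to permutation matrices.
  rw [doublyStochastic_eq_convexHull_permMatrix] at hmem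
  exact convexHull_min hsub hconv hmem

/-- The entrywise square of an orthogonal matrix is doubly stochastic. -/
theorem sq_mem_doublyStochastic {ι : Type*} [Fintype ι] [DecidableEq ι] {Q : Matrix ι ι ℝ}
    (h₁ : Q * Qᵀ = 1) (h₂ : Qᵀ * Q = 1) :
    (Matrix.of fun i j => Q i j ^ 2) ∈ doublyStochastic ℝ ι := by
  rw [mem_doublyStochastic_iff_sum]
  refine ⟨fun i j => sq_nonneg _, fun i => ?_, fun j => ?_⟩
  · have := congrFun (congrFun h₁ i) i
    simpa [Matrix.mul_apply, sq] using this
  · have := congrFun (congrFun h₂ j) j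
    simpa [Matrix.mul_apply, sq] using this

/-- The spectral theorem for real symmetric matrices. -/
theorem exists_orthogonal_diagonalization {ι : Type*} [Fintype ι] [DecidableEq ι]
    {X : Matrix ι ι ℝ} (hX : X.IsHermitian) :
    ∃ V : Matrix ι ι ℝ, V * Vᵀ = 1 ∧ Vᵀ * V = 1 ∧
      X = V * Matrix.diagonal hX.eigenvalues * Vᵀ := by
  refine ⟨(hX.eigenvectorUnitary : Matrix ι ι ℝ), ?_, ?_, ?_⟩
  · exact Unitary.coe_mul_star_self hX.eigenvectorUnitary
  · exact Unitary.coe_star_mul_self hX.eigenvectorUnitary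
  · exact hX.spectral_theorem

/-- For weights oppositely ordered to the eigenvalues of `Y`, the weighted sum of the diagonal of
`Y` in any orthonormal basis is at least the weighted sum of the eigenvalues. -/
theorem sum_mul_eigenvalues_le_sum_mul_conj_diag {ι : Type*} [Fintype ι] [DecidableEq ι]
    {U Y : Matrix ι ι ℝ} (h₁ : U * Uᵀ = 1) (h₂ : Uᵀ * U = 1) (hY : Y.IsHermitian)
    {w : ι → ℝ} (hw : Antivary w hY.eigenvalues) :
    ∑ i, w i * hY.eigenvalues i ≤ ∑ i, w i * (Uᵀ * Y * U) i i := by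
  obtain ⟨V, hV₁, hV₂, hspec⟩ := exists_orthogonal_diagonalization hY
  -- The diagonal of `Uᵀ * Y * U` is the entrywise square of `Uᵀ * V` applied to the eigenvalues of
  -- `Y`.
  have hQ := sq_mem_doublyStochastic (Q := Uᵀ * V)
    (by rw [Matrix.transpose_mul, Matrix.transpose_transpose, Matrix.mul_assoc,
          ← Matrix.mul_assoc V, hV₁, Matrix.one_mul, h₂])
    (by rw [Matrix.transpose_mul, Matrix.transpose_transpose, Matrix.mul_assoc,
          ← Matrix.mul_assoc U, h₁, Matrix.one_mul, hV₂])
  refine (hw.sum_mul_le_dotProduct_mulVec hQ).trans_eq ?_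
  refine Finset.sum_congr rfl fun i _ => ?_
  congr 1
  have hconj : Uᵀ * Y * U = (Uᵀ * V) * Matrix.diagonal hY.eigenvalues * (Uᵀ * V)ᵀ := by
    conv_lhs => rw [hspec]
    simp only [Matrix.transpose_mul, Matrix.transpose_transpose, Matrix.mul_assoc]
  rw [hconj, Matrix.mul_apply]
  simp only [Matrix.mulVec, dotProduct, Matrix.of_apply, Matrix.mul_diagonal,
    Matrix.transpose_apply]
  exact Finset.sum_congr rfl fun j _ => by ring

/-! ### Ordered eigenvalues indexed from 1. -/

theorem eig_eq_eigenvalues₀ {n : ℕ} {X : Matrix (Fin n) (Fin n) ℝ} (hX : X.IsHermitian)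
    (k : Fin (Fintype.card (Fin n))) : eig X (k + 1) = hX.eigenvalues₀ k := by
  have hk : (k : ℕ) < n := by simpa using k.2
  unfold eig
  rw [dif_pos ⟨hX, by omega, by omega⟩]
  rfl

theorem eig_of_lt {n : ℕ} (X : Matrix (Fin n) (Fin n) ℝ) {i : ℕ} (hi : n < i) : eig X i = 0 := by
  unfold eig
  rw [dif_neg (by omega)]

theorem eig_antitoneOn {n : ℕ} {X : Matrix (Fin n) (Fin n) ℝ} (hX : X.IsHermitian) {i j : ℕ}
    (hi : 1 ≤ i) (hij : i ≤ j) (hj : j ≤ n) : eig X j ≤ eig X i := by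
  have h1 := eig_eq_eigenvalues₀ hX ⟨i - 1, by rw [Fintype.card_fin]; omega⟩
  have h2 := eig_eq_eigenvalues₀ hX ⟨j - 1, by rw [Fintype.card_fin]; omega⟩
  simp only [Nat.sub_add_cancel hi, Nat.sub_add_cancel (hi.trans hij)] at h1 h2
  rw [h1, h2]
  exact hX.eigenvalues₀_antitone (by simp only [Fin.mk_le_mk]; omega)

theorem eig_nonneg {n : ℕ} {X : Matrix (Fin n) (Fin n) ℝ} (hX : X.PosSemidef) (i : ℕ) :
    0 ≤ eig X i := by
  by_cases h : 1 ≤ i ∧ i ≤ n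
  · have h1 := eig_eq_eigenvalues₀ hX.isHermitian ⟨i - 1, by rw [Fintype.card_fin]; omega⟩
    simp only [Nat.sub_add_cancel h.1] at h1
    have := hX.eigenvalues_nonneg (Fintype.equivOfCardEq (Fintype.card_fin _)
      ⟨i - 1, by rw [Fintype.card_fin]; omega⟩)
    rw [Matrix.IsHermitian.eigenvalues, Equiv.symm_apply_apply] at this
    rwa [h1]
  · unfold eig
    rw [dif_neg (by tauto)]

/-- Nonnegativity extends the ordering past `n`, where `eig` is `0`; this covers the index `s + 1`
when `s = n`. -/
theorem eig_antitone {n : ℕ} {X : Matrix (Fin n) (Fin n) ℝ} (hX : X.PosSemidef) {i j : ℕ}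
    (hi : 1 ≤ i) (hij : i ≤ j) : eig X j ≤ eig X i := by
  by_cases hj : j ≤ n
  · exact eig_antitoneOn hX.isHermitian hi hij hj
  · rw [eig_of_lt X (by omega)]
    exact eig_nonneg hX i

/-- The position of `i` in the decreasing order of the eigenvalues `IsHermitian.eigenvalues`. -/
noncomputable def rank {n : ℕ} (i : Fin n) : ℕ :=
  ((Fintype.equivOfCardEq (Fintype.card_fin (Fintype.card (Fin n)))).symm i :
    Fin (Fintype.card (Fin n))) + 1

theorem eig_rank {n : ℕ} {X : Matrix (Fin n) (Fin n) ℝ} (hX : X.IsHermitian) (i : Fin n) :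
    eig X (rank i) = hX.eigenvalues i :=
  eig_eq_eigenvalues₀ hX _

theorem one_le_rank {n : ℕ} (i : Fin n) : 1 ≤ rank i := Nat.le_add_left _ _

theorem rank_le {n : ℕ} (i : Fin n) : rank i ≤ n := by
  rw [← Nat.lt_succ_iff]
  exact Nat.succ_lt_succ (lt_of_lt_of_eq (Fin.is_lt _) (Fintype.card_fin n))

theorem sum_rank {n : ℕ} (f : ℕ → ℝ) : ∑ i : Fin n, f (rank i) = ∑ i ∈ Finset.Icc 1 n, f i := by
  unfold rank
  rw [Equiv.sum_comp (Fintype.equivOfCardEq (Fintype.card_fin (Fintype.card (Fin n)))).symm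
    (fun k : Fin (Fintype.card (Fin n)) => f (k + 1)),
    Fin.sum_univ_eq_sum_range (fun k => f (k + 1)), Fintype.card_fin,
    Finset.range_eq_Ico, Finset.sum_Ico_add' f 0 n 1, zero_add]
  rfl

theorem sum_Icc_split {s n : ℕ} (hsn : s ≤ n) (f : ℕ → ℝ) :
    ∑ i ∈ Finset.Icc 1 n, f i = ∑ i ∈ Finset.Icc 1 s, f i + ∑ i ∈ Finset.Icc (s + 1) n, f i := by
  have h := Finset.sum_Ico_consecutive f (Nat.le_add_left 1 s) (Nat.add_le_add_right hsn 1)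
  exact h.symm

/-! ### Upper bound on the concave envelope. -/

theorem log_add_le_tangent {a b t : ℝ} (ha : 0 ≤ a) (hb : 0 ≤ b) (ht : 0 < t) :
    Real.log (b + t) ≤ Real.log (a + t) + 1 / (a + t) * (b - a) := by
  have ha' : 0 < a + t := by linarith
  have hb' : 0 < b + t := by linarith
  have h := Real.log_le_sub_one_of_pos (div_pos hb' ha')
  rw [Real.log_div hb'.ne' ha'.ne'] at h
  have : (b + t) / (a + t) - 1 = 1 / (a + t) * (b - a) := by field_simp; ring
  linarith

theorem convex_posSemidef (n : ℕ) : Convex ℝ {Y : Matrix (Fin n) (Fin n) ℝ | Y.PosSemidef} :=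
  fun _ hX _ hY _ _ ha hb _ => (hX.smul ha).add (hY.smul hb)

/-- The value `f x` bounds the set below, so the real `sInf` is a true infimum. -/
theorem concaveEnvelope_le {E : Type*} [AddCommGroup E] [Module ℝ E] {D : Set E} {f g : E → ℝ}
    (hg : ConcaveOn ℝ D g) (hfg : ∀ z ∈ D, f z ≤ g z) {x : E} (hx : x ∈ D) :
    concaveEnvelope D f x ≤ g x := by
  refine csInf_le ⟨f x, ?_⟩ ⟨g, hg, hfg, rfl⟩
  rintro _ ⟨h, -, hfh, rfl⟩
  exact hfh x hx

/-- Bound on the concave envelope by the affine majorant of `Φ_s` that has the reciprocals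
`1 / (λ_{min (i, s)}(X) + t)` as its slopes along the eigenvectors of `X`. -/
theorem PhiHat_le {n s : ℕ} (hs : 1 ≤ s) (hsn : s ≤ n) {t : ℝ} (ht : 0 < t)
    {X : Matrix (Fin n) (Fin n) ℝ} (hX : X.PosSemidef) :
    PhiHat s t X ≤ ∑ i ∈ Finset.Icc 1 s, Real.log (eig X i + t) +
      1 / (eig X s + t) * ∑ i ∈ Finset.Icc (s + 1) n, eig X i := by
  have hXh := hX.isHermitian
  obtain ⟨U, hU₁, hU₂, hspec⟩ := exists_orthogonal_diagonalization hXh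
  have hdiag : Uᵀ * X * U = Matrix.diagonal hXh.eigenvalues := by
    conv_lhs => rw [hspec]
    rw [Matrix.mul_assoc, Matrix.mul_assoc, hU₂, Matrix.mul_one, ← Matrix.mul_assoc, hU₂,
      Matrix.one_mul]
  -- Beyond `s`, the constant continuation is the smallest that keeps `w` nondecreasing.
  set w : ℕ → ℝ := fun k => 1 / (eig X (min k s) + t) with hw
  have hpos : ∀ k, 0 < eig X k + t := fun k => by linarith [eig_nonneg hX k]
  have hwpos : ∀ k, 0 ≤ w k := fun k => (one_div_pos.2 (hpos _)).le
  have hwmono : ∀ i j, 1 ≤ i → i ≤ j → w i ≤ w j := fun i j hi hij =>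
    one_div_le_one_div_of_le (hpos _) (by
      have := eig_antitone hX (i := min i s) (j := min j s) (by omega) (by omega)
      linarith)
  -- The sum of the intercepts of the tangents at the top `s` eigenvalues of `X`.
  set c : ℝ := ∑ i ∈ Finset.Icc 1 s, (Real.log (eig X i + t) - w i * eig X i) with hc
  set g : Matrix (Fin n) (Fin n) ℝ → ℝ :=
    fun Y => ∑ i, w (rank i) * (Uᵀ * Y * U) i i + c with hg
  have hgconc : ConcaveOn ℝ {Y : Matrix (Fin n) (Fin n) ℝ | Y.PosSemidef} g := by
    refine ⟨convex_posSemidef n, fun Y _ Z _ a b _ _ hab => le_of_eq ?_⟩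
    simp only [hg, mul_add, Matrix.add_mul, Matrix.mul_smul, Matrix.smul_mul,
      Matrix.add_apply, Matrix.smul_apply, smul_eq_mul, Finset.sum_add_distrib,
      Finset.mul_sum]
    have hcc : c = a * c + b * c := by rw [← add_mul, hab, one_mul]
    have e : ∀ (r : ℝ) (Y : Matrix (Fin n) (Fin n) ℝ),
        ∑ i, w (rank i) * (r * (Uᵀ * Y * U) i i) = ∑ i, r * (w (rank i) * (Uᵀ * Y * U) i i) :=
      fun r Y => Finset.sum_congr rfl fun i _ => by ring
    rw [e, e]
    linarith
  have hmaj : ∀ Y ∈ {Y : Matrix (Fin n) (Fin n) ℝ | Y.PosSemidef}, Phi s t Y ≤ g Y := by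
    intro Y hY
    have hYp : Y.PosSemidef := hY
    have hYh := hYp.isHermitian
    have hanti : Antivary (fun i : Fin n => w (rank i)) hYh.eigenvalues := by
      intro i j hij
      rw [← eig_rank hYh, ← eig_rank hYh] at hij
      have : rank j ≤ rank i := by
        by_contra! hlt
        exact absurd (eig_antitone hYp (one_le_rank i) hlt.le) (not_le.2 hij)
      exact hwmono _ _ (one_le_rank j) this
    have hring := sum_mul_eigenvalues_le_sum_mul_conj_diag hU₁ hU₂ hYh hanti
    simp only [← eig_rank hYh] at hring
    rw [sum_rank (fun k => w k * eig Y k), sum_Icc_split hsn] at hring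
    have htail : 0 ≤ ∑ i ∈ Finset.Icc (s + 1) n, w i * eig Y i :=
      Finset.sum_nonneg fun i _ => mul_nonneg (hwpos i) (eig_nonneg hYp i)
    have htan : Phi s t Y ≤ ∑ i ∈ Finset.Icc 1 s, w i * eig Y i + c := by
      rw [hc, ← Finset.sum_add_distrib]
      refine Finset.sum_le_sum fun i hi => ?_
      have hi' := (Finset.mem_Icc.1 hi).2
      have := log_add_le_tangent (eig_nonneg hX i) (eig_nonneg hYp i) ht
      simp only [hw, min_eq_left hi']
      linarith
    simp only [hg]
    linarith
  refine (concaveEnvelope_le hgconc hmaj hX).trans_eq ?_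
  simp only [hg, hdiag, Matrix.diagonal_apply_eq, ← eig_rank hXh]
  rw [sum_rank (fun k => w k * eig X k), sum_Icc_split hsn, hc, Finset.sum_sub_distrib,
    Finset.mul_sum]
  have : ∑ i ∈ Finset.Icc (s + 1) n, w i * eig X i =
      ∑ i ∈ Finset.Icc (s + 1) n, 1 / (eig X s + t) * eig X i := by
    refine Finset.sum_congr rfl fun i hi => ?_
    have hi' := (Finset.mem_Icc.1 hi).1
    simp only [hw, min_eq_right (by omega : s ≤ i)]
  rw [this]
  ring

/-! ### Log-determinant and the gap at one matrix. -/

theorem det_add_smul_one {n : ℕ} {X : Matrix (Fin n) (Fin n) ℝ} (hX : X.IsHermitian) (t : ℝ) :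
    (X + t • (1 : Matrix (Fin n) (Fin n) ℝ)).det = ∏ i, (hX.eigenvalues i + t) := by
  obtain ⟨V, hV₁, -, hspec⟩ := exists_orthogonal_diagonalization hX
  have h : X + t • (1 : Matrix (Fin n) (Fin n) ℝ) =
      V * Matrix.diagonal (fun i => hX.eigenvalues i + t) * Vᵀ := by
    have hd : Matrix.diagonal (fun i => hX.eigenvalues i + t) =
        Matrix.diagonal hX.eigenvalues + t • (1 : Matrix (Fin n) (Fin n) ℝ) := by
      ext i j
      by_cases hij : i = j <;> simp [hij]
    rw [hd, Matrix.mul_add, Matrix.add_mul, ← hspec, Matrix.mul_smul, Matrix.smul_mul,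
      Matrix.mul_one, hV₁]
  rw [h, Matrix.det_mul_right_comm, hV₁, Matrix.one_mul, Matrix.det_diagonal]

theorem log_det_add_smul_one {n : ℕ} {X : Matrix (Fin n) (Fin n) ℝ} (hX : X.PosSemidef) {t : ℝ}
    (ht : 0 < t) :
    Real.log (X + t • (1 : Matrix (Fin n) (Fin n) ℝ)).det =
      ∑ i ∈ Finset.Icc 1 n, Real.log (eig X i + t) := by
  rw [det_add_smul_one hX.isHermitian, Real.log_prod, ← sum_rank]
  · simp only [eig_rank hX.isHermitian]
  · intro i _
    have := hX.eigenvalues_nonneg i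
    positivity

/-- The tangent at `a`, evaluated at `0`. -/
theorem div_add_le_log_add_sub_log {a t : ℝ} (ha : 0 ≤ a) (ht : 0 < t) :
    1 / (a + t) * a ≤ Real.log (a + t) - Real.log t := by
  have := log_add_le_tangent ha le_rfl ht
  rw [zero_add] at this
  linarith

/-- The gap between `log det` and the concave envelope of `Φ_s` at a single matrix. -/
theorem le_log_det_sub_PhiHat {n s : ℕ} (hs : 1 ≤ s) (hsn : s ≤ n) {t : ℝ} (ht : 0 < t)
    {X : Matrix (Fin n) (Fin n) ℝ} (hX : X.PosSemidef) :
    (1 / (eig X (s + 1) + t) - 1 / (eig X s + t)) * ∑ i ∈ Finset.Icc (s + 1) n, eig X i ≤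
      Real.log (X + t • (1 : Matrix (Fin n) (Fin n) ℝ)).det - ((n : ℝ) - s) * Real.log t
        - PhiHat s t X := by
  have h1 := PhiHat_le hs hsn ht hX
  rw [log_det_add_smul_one hX ht, sum_Icc_split hsn]
  have h2 : 1 / (eig X (s + 1) + t) * ∑ i ∈ Finset.Icc (s + 1) n, eig X i ≤
      ∑ i ∈ Finset.Icc (s + 1) n, (Real.log (eig X i + t) - Real.log t) := by
    rw [Finset.mul_sum]
    refine Finset.sum_le_sum fun i hi => ?_
    have hi' := (Finset.mem_Icc.1 hi).1
    have hnn := eig_nonneg hX i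
    refine le_trans ?_ (div_add_le_log_add_sub_log hnn ht)
    refine mul_le_mul_of_nonneg_right (one_div_le_one_div_of_le (by linarith) ?_) hnn
    linarith [eig_antitone hX (by omega : 1 ≤ s + 1) hi']
  rw [Finset.sum_sub_distrib, Finset.sum_const, Nat.card_Icc, nsmul_eq_mul,
    show n + 1 - (s + 1) = n - s by omega, Nat.cast_sub hsn] at h2
  rw [sub_mul]
  linarith

/-! ### Attainment and positivity of the smallest eigenvalue. -/

theorem M_posSemidef {n s : ℕ} (A : Matrix (Fin n) (Fin n) ℝ) {x : Fin n → ℝ}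
    (hx : x ∈ feasible n s) : (M A x).PosSemidef := by
  refine Matrix.posSemidef_sum _ fun i _ => Matrix.PosSemidef.smul ?_ (hx.1 i).1
  simpa using Matrix.posSemidef_vecMulVec_self_star (A.col i)

theorem isCompact_feasible (n s : ℕ) : IsCompact (feasible n s) := by
  have h : feasible n s =
      (Set.univ.pi fun _ => Set.Icc (0 : ℝ) 1) ∩ {x : Fin n → ℝ | ∑ i, x i = (s : ℝ)} := by
    ext x
    simp only [feasible, Set.mem_inter_iff, Set.mem_univ_pi, Set.mem_ofPred_eq]
  rw [h]
  exact (isCompact_univ_pi fun _ => isCompact_Icc).inter_right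
    (isClosed_eq (by fun_prop) continuous_const)

theorem continuousOn_ddfObj {n : ℕ} (s : ℕ) (A : Matrix (Fin n) (Fin n) ℝ) {t : ℝ} (ht : 0 < t) :
    ContinuousOn (ddfObj A t) (feasible n s) := by
  refine ContinuousOn.log (Continuous.continuousOn ?_) fun x hx => ?_
  · refine Continuous.matrix_det (Continuous.add ?_ continuous_const)
    exact continuous_finsetSum _ fun i _ => (continuous_apply i).smul continuous_const
  · exact ((Matrix.PosDef.posSemidef_add (M_posSemidef A hx)
      (Matrix.PosDef.one.smul ht)).det_pos).ne'

theorem lambdaMin_pos {n : ℕ} (hn : 1 ≤ n) {C : Matrix (Fin n) (Fin n) ℝ} (hC : C.PosDef) :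
    0 < lambdaMin C := by
  have h1 := eig_eq_eigenvalues₀ hC.isHermitian ⟨n - 1, by rw [Fintype.card_fin]; omega⟩
  simp only [Nat.sub_add_cancel hn] at h1
  have := hC.eigenvalues_pos (Fintype.equivOfCardEq (Fintype.card_fin _)
    ⟨n - 1, by rw [Fintype.card_fin]; omega⟩)
  rw [Matrix.IsHermitian.eigenvalues, Equiv.symm_apply_apply] at this
  rwa [lambdaMin, h1]

theorem _root_.IsMaxOn.sSup_image_eq {α : Type*} {f : α → ℝ} {S : Set α} {x : α}
    (h : IsMaxOn f S x) (hx : x ∈ S) : sSup (f '' S) = f x :=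
  IsGreatest.csSup_eq ⟨⟨x, hx, rfl⟩, by rintro _ ⟨y, hy, rfl⟩; exact h hy⟩

end MESP

theorem theorem5 (n s : ℕ) (hs : 1 ≤ s) (hsn : s ≤ n)
    (C : Matrix (Fin n) (Fin n) ℝ) (hC : C.PosDef)
    (t : ℝ) (ht : t = MESP.lambdaMin C)
    (A : Matrix (Fin n) (Fin n) ℝ)
    (hA : C - t • (1 : Matrix (Fin n) (Fin n) ℝ) = Aᵀ * A)
    (x : Fin n → ℝ) (hx : x ∈ MESP.feasible n s)
    (hopt : IsMaxOn (MESP.augFactObj A s t) (MESP.feasible n s) x)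
    (lam : ℕ → ℝ) (hlam : ∀ i, lam i = MESP.eig (MESP.M A x) i) :
    -- the maximum in the definition of the DDF-R bound is attained
    (∃ y ∈ MESP.feasible n s, IsMaxOn (MESP.ddfObj A t) (MESP.feasible n s) y) ∧
    -- the gap is at least the lower bound, and the lower bound is nonnegative
    MESP.zHatD A s t - MESP.zHat A s t ≥
      (1 / (lam (s + 1) + t) - 1 / (lam s + t)) * ∑ i ∈ Finset.Icc (s + 1) n, lam i ∧
    (1 / (lam (s + 1) + t) - 1 / (lam s + t)) * ∑ i ∈ Finset.Icc (s + 1) n, lam i ≥ 0 := by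
  have htpos : 0 < t := ht ▸ MESP.lambdaMin_pos (hs.trans hsn) hC
  have hX := MESP.M_posSemidef A hx
  obtain ⟨y, hy, hymax⟩ := (MESP.isCompact_feasible n s).exists_isMaxOn ⟨x, hx⟩
    (MESP.continuousOn_ddfObj s A htpos)
  simp only [hlam]
  refine ⟨⟨y, hy, hymax⟩, ?_, ?_⟩
  · have hgap := MESP.le_log_det_sub_PhiHat hs hsn htpos hX
    -- Replacing `y` by the maximizer `x` of the other bound only lowers the gap.
    have hxy : MESP.ddfObj A t x ≤ MESP.ddfObj A t y := hymax hx
    rw [MESP.zHatD, MESP.zHat, hymax.sSup_image_eq hy, hopt.sSup_image_eq hx]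
    simp only [MESP.ddfObj, MESP.augFactObj] at hxy ⊢
    linarith
  · refine mul_nonneg (sub_nonneg.2 (one_div_le_one_div_of_le ?_ ?_))
      (Finset.sum_nonneg fun i _ => MESP.eig_nonneg hX i)
    · linarith [MESP.eig_nonneg hX (s + 1)]
    · linarith [MESP.eig_antitone hX hs (Nat.le_succ s)]
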